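/- There are absolute constants $c, C, c', C' > 0$ such that the following holds. For $\varepsilon>0$, say that a real polynomial $f(x,y)$ makes a sharp turn of size $\varepsilon$ if $f>0$ on $\{\varepsilon \le x \le 1,\ -1\le y\le 1\}$ and on $\{\varepsilon\le y\le 1,\ -1\le x\le 1\}$, and $f<0$ on $\{-1\le x\le -\varepsilon,\ -1\le y\le-\varepsilon\}$. (1) If a real polynomial $f(x,y)$ of (total) degree $n$ makes a sharp turn of size $\varepsilon>0$, then $\varepsilon \ge c\,e^{-Cn^2}$. (2) Conversely, for every $n\ge 1$ there is a real polynomial $f(x,y)$ of degree exactly $n$ that makes a sharp turn of some size $0<\varepsilon<1$ with $\varepsilon\le c' e^{-C'n}$. Moreover, for every $n\ge 3$ a polynomial of degree at most $n$ that makes a sharp turn of some size $0<\varepsilon<1$ with $\varepsilon\le c' e^{-C'n}$ can be found among the polynomials $$p(y)\,g(x)+y\,q(y)\,g(-x),\qquad g(x)=\prod_{m=1}^{N}(x+2^{-m})^2,\quad p=p_M,\ q=q_M,$$ with $N, M\ge 0$ integers and $0<a<1$, where the even polynomials $p_m,q_m$ are defined by $p_0=q_0=1$, $K_0=1/a$ and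 $$p_{m+1}=p_m^2+K_m y^2q_m^2,\qquad q_{m+1}=2\sqrt{K_m}\,p_mq_m,\qquad K_{m+1}=\tfrac12\Big(\sqrt{K_m}+\tfrac1{\sqrt{K_m}}\Big).$$ -/

import Mathlib

/-- `f` makes a sharp turn of size `ε` at the origin: it is positive on
`{ε ≤ x ≤ 1, |y| ≤ 1}` and on `{ε ≤ y ≤ 1, |x| ≤ 1}`, and negative on `{-1 ≤ x, y ≤ -ε}`.
The variable `x` is number `0` and `y` is number `1`. -/
def IsSharpTurn (f : MvPolynomial (Fin 2) ℝ) (ε : ℝ) : Prop :=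
  (∀ x y : ℝ, ε ≤ x → x ≤ 1 → -1 ≤ y → y ≤ 1 → 0 < MvPolynomial.eval ![x, y] f) ∧
  (∀ x y : ℝ, ε ≤ y → y ≤ 1 → -1 ≤ x → x ≤ 1 → 0 < MvPolynomial.eval ![x, y] f) ∧
  (∀ x y : ℝ, -1 ≤ x → x ≤ -ε → -1 ≤ y → y ≤ -ε → MvPolynomial.eval ![x, y] f < 0)

namespace SharpTurn

/-- The numbers `K₀ = 1/a`, `K_{m+1} = (√K_m + 1/√K_m)/2`. -/
noncomputable def K (a : ℝ) : ℕ → ℝ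
  | 0 => 1 / a
  | m + 1 => (Real.sqrt (K a m) + 1 / Real.sqrt (K a m)) / 2

/-- The pairs `(p₀, q₀) = (1, 1)`,
`(p_{m+1}, q_{m+1}) = (p_m² + K_m y² q_m², 2 √K_m p_m q_m)` of even polynomials in one variable. -/
noncomputable def pq (a : ℝ) : ℕ → Polynomial ℝ × Polynomial ℝ
  | 0 => (1, 1)
  | m + 1 =>
    ((pq a m).1 ^ 2 + Polynomial.C (K a m) * Polynomial.X ^ 2 * (pq a m).2 ^ 2,
      Polynomial.C (2 * Real.sqrt (K a m)) * (pq a m).1 * (pq a m).2)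

/-- `g(x) = ∏_{m=1}^{N} (x + 2^{-m})²`. -/
noncomputable def g (N : ℕ) : Polynomial ℝ :=
  ∏ m ∈ Finset.Icc 1 N, (Polynomial.X + Polynomial.C (1 / 2 ^ m : ℝ)) ^ 2

/-- The polynomial `p(y) g(x) + y q(y) g(-x)` with `p = p_m`, `q = q_m` for the parameter `a`
and `g` with `N` factors. -/
noncomputable def superposition (a : ℝ) (m N : ℕ) : MvPolynomial (Fin 2) ℝ :=
  Polynomial.aeval (MvPolynomial.X 1) (pq a m).1 * Polynomial.aeval (MvPolynomial.X 0) (g N) +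
    MvPolynomial.X 1 * Polynomial.aeval (MvPolynomial.X 1) (pq a m).2 *
      Polynomial.aeval (-MvPolynomial.X 0) (g N)

end SharpTurn

/-! ### Lower bound: dominant homogeneous parts and Chebyshev growth. -/

section LowerBound

/-! Lower bound: among about `n` geometric scales `t`, one has `f(tu) ≈ t^d P(u)` for a single
homogeneous part `P` (`exists_scale_of_dominant_term`). If `ε < t/2`, the signs of `f` at `u` and
`-u` contradict the parity of `P` unless `P` is tiny on a box (`IsSharpTurn.exists_box`). Chebyshev
growth then makes `P` smaller on the whole square than its own maximum. Each scale step costs a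
factor exponential in `n`, whence `exp(-Cn²)`.

Upper bound: for `x ≥ a = 2^{-N}` the product `g` satisfies `9 g(-x) ≤ g(x)`, and `yq/p` is a
rational approximation of `sign y` with `1/K ≤ |y|q/p ≤ 1` for `a ≤ |y| ≤ 1`. If `K < 9`, then
`p(y)g(x)` wins for `x ≥ a`, and `yq(y)g(-x)` wins when both variables are at most `-a`; for `y > 0`
neither term is negative. Since `K_{m+1}² ≤ K_m`, degree `2^M` brings `K` down to 2 for `a =
2^{-2^M}`. A small multiple of `x^n` corrects the degree. -/

theorem eval_T_le_two_mul_pow {x : ℝ} (hx : 1 ≤ x) (n : ℕ) :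
    (Polynomial.Chebyshev.T ℝ n).eval x ≤ (2 * x) ^ n := by
  induction n with
  | zero => simp
  | succ n ih =>
    cases n with
    | zero => simp; linarith
    | succ n =>
      have h1 := Polynomial.Chebyshev.one_le_eval_T_real n hx
      have h2 : (Polynomial.Chebyshev.T ℝ ((n + 1 + 1 : ℕ) : ℤ)).eval x =
          2 * x * (Polynomial.Chebyshev.T ℝ ((n + 1 : ℕ) : ℤ)).eval x -
            (Polynomial.Chebyshev.T ℝ (n : ℤ)).eval x := by
        simp [add_assoc, one_add_one_eq_two]
      rw [h2, pow_succ]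
      nlinarith [mul_le_mul_of_nonneg_left ih (by linarith : 0 ≤ 2 * x)]

/-- Chebyshev polynomials grow fastest outside `[-1, 1]`; apply this to `±P/δ`. -/
theorem abs_eval_le_of_abs_le_on_Icc {P : Polynomial ℝ} {n : ℕ} (hP : P.natDegree ≤ n) {δ : ℝ}
    (hδ : 0 < δ) (hb : ∀ s ∈ Set.Icc (-1 : ℝ) 1, |P.eval s| ≤ δ) {x : ℝ} (hx : 1 ≤ x) :
    |P.eval x| ≤ (2 * x) ^ n * δ := by
  have key : ∀ r : ℝ, |r| = δ⁻¹ → r * P.eval x ≤ (2 * x) ^ n := by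
    intro r hr
    have := Polynomial.Chebyshev.eval_iterate_derivative_le_of_forall_abs_le_one (k := 0)
      (P := Polynomial.C r * P) (n := n) hx
      (Polynomial.natDegree_le_iff_degree_le.1 ((Polynomial.natDegree_C_mul_le _ _).trans hP))
      (fun s hs => by
        rw [Polynomial.eval_mul, Polynomial.eval_C, abs_mul, hr, inv_mul_le_iff₀ hδ, mul_one]
        exact hb s hs)
    simp only [Function.iterate_zero, id, Polynomial.eval_mul, Polynomial.eval_C] at this
    exact this.trans (eval_T_le_two_mul_pow hx n)
  have h1 := key δ⁻¹ (abs_of_pos (by positivity))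
  have h2 := key (-δ⁻¹) (by rw [abs_neg, abs_of_pos (by positivity)])
  have e : P.eval x = δ * (δ⁻¹ * P.eval x) := by field_simp
  rw [abs_le, e]
  constructor <;> nlinarith

theorem MvPolynomial.natDegree_aeval_line_le {σ : Type*} (P : MvPolynomial σ ℝ) (c w : σ → ℝ) :
    (MvPolynomial.aeval (fun i => Polynomial.C (c i) + Polynomial.C (w i) * Polynomial.X)
      P).natDegree ≤ P.totalDegree := by
  refine (MvPolynomial.aeval_natDegree_le (m := P.totalDegree) (n := 1) P le_rfl _ fun i => ?_).trans
    (by simp)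
  compute_degree

/-- Restrict to the line `s ↦ c + s(v - c)/7`: since `|v i - c i| ≤ 7/4`, it stays in the box for
`|s| ≤ 1`, and it reaches `v` at `s = 7`. Hence `14 = 2 · 7`. -/
theorem abs_eval_le_of_abs_le_on_box {σ : Type*} (P : MvPolynomial σ ℝ) {d : ℕ}
    (hP : P.totalDegree ≤ d) {c : σ → ℝ} (hc : ∀ i, |c i| ≤ 3 / 4) {δ : ℝ} (hδ : 0 < δ)
    (hb : ∀ u : σ → ℝ, (∀ i, |u i - c i| ≤ 1 / 4) → |MvPolynomial.eval u P| ≤ δ)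
    {v : σ → ℝ} (hv : ∀ i, |v i| ≤ 1) : |MvPolynomial.eval v P| ≤ 14 ^ d * δ := by
  set w : σ → ℝ := fun i => (v i - c i) / 7 with hw
  set Q : Polynomial ℝ :=
    MvPolynomial.aeval (fun i => Polynomial.C (c i) + Polynomial.C (w i) * Polynomial.X) P with hQ
  have hev : ∀ s : ℝ, Q.eval s = MvPolynomial.eval (fun i => c i + w i * s) P := by
    intro s
    rw [hQ, ← Polynomial.coe_aeval_eq_eval, MvPolynomial.comp_aeval_apply,
      MvPolynomial.aeval_eq_eval]
    simp [Polynomial.coe_aeval_eq_eval]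
  have h7 := abs_eval_le_of_abs_le_on_Icc (P := Q) (n := d)
    ((MvPolynomial.natDegree_aeval_line_le P c w).trans hP) hδ (fun s hs => by
      rw [hev]
      refine hb _ fun i => ?_
      have h1 := abs_le.1 (hc i)
      have h2 := abs_le.1 (hv i)
      have h3 : |w i| ≤ 1 / 4 := by
        rw [hw, abs_le]; constructor <;> simp only <;> linarith
      rw [add_sub_cancel_left, abs_mul]
      have h4 : |s| ≤ 1 := abs_le.2 hs
      nlinarith [abs_nonneg s, abs_nonneg (w i)]) (x := 7) (by norm_num)
  rw [hev] at h7
  have e : (fun i => c i + w i * 7) = v := by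
    ext i; simp only [hw]; ring
  rw [e] at h7
  norm_num at h7 ⊢
  exact h7

theorem exists_succ_eq_of_antitone {n : ℕ} (D : ℕ → ℕ) (h0 : D 0 ≤ n)
    (hD : ∀ k, D (k + 1) ≤ D k) : ∃ k ≤ n, D (k + 1) = D k := by
  by_contra! h
  have : ∀ k ≤ n + 1, D k + k ≤ n := by
    intro k
    induction k with
    | zero => intro _; simpa using h0
    | succ k ih =>
      intro hk
      have := ih (by omega)
      have := hD k
      have := h k (by omega)
      omega
  have := this (n + 1) le_rfl
  omega

/-- Among the monomials `A e * t ^ e`, at some scale `t = θ ^ (2k+1)` a single one dominates. -/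
theorem exists_scale_of_dominant_term (n : ℕ) (A : ℕ → ℝ) (hA : ∀ e, 0 ≤ A e)
    (hA0 : ∃ e ≤ n, 0 < A e) {θ : ℝ} (hθ : 0 < θ) (hθ1 : θ < 1) :
    ∃ k ≤ n, ∃ d ≤ n, 0 < A d ∧ ∀ e ≤ n, e ≠ d →
      (θ ^ (2 * k + 1)) ^ e * A e ≤ θ * ((θ ^ (2 * k + 1)) ^ d * A d) := by
  have hex : ∀ k : ℕ, ∃ d ≤ n, ∀ e ≤ n, (θ ^ (2 * k)) ^ e * A e ≤ (θ ^ (2 * k)) ^ d * A d := by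
    intro k
    obtain ⟨d, hd, hmax⟩ := Finset.exists_max_image (Finset.range (n + 1))
      (fun e => (θ ^ (2 * k)) ^ e * A e) ⟨0, by simp⟩
    exact ⟨d, by simpa [Nat.lt_succ_iff] using hd,
      fun e he => hmax e (by simpa [Nat.lt_succ_iff] using he)⟩
  choose D hDn hDmax using hex
  have hpos : ∀ k, 0 < A (D k) := by
    intro k
    obtain ⟨e, he, hepos⟩ := hA0
    have h := hDmax k e he
    have h1 : 0 < (θ ^ (2 * k)) ^ e * A e := by positivity
    exact pos_of_mul_pos_right (h1.trans_le h) (by positivity)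
  -- Shrinking the scale favours low degrees.
  have hanti : ∀ k, D (k + 1) ≤ D k := by
    intro k
    by_contra! hlt
    have h1 := hDmax (k + 1) (D k) (hDn k)
    have h2 := hDmax k (D (k + 1)) (hDn (k + 1))
    have hs : ∀ e : ℕ, (θ ^ (2 * (k + 1))) ^ e = (θ ^ (2 * k)) ^ e * (θ ^ 2) ^ e := by
      intro e; rw [← mul_pow]; congr 1; ring
    rw [hs, hs] at h1
    have hlt' : (θ ^ 2) ^ D (k + 1) < (θ ^ 2) ^ D k :=
      pow_lt_pow_right_of_lt_one₀ (by positivity) (by nlinarith) hlt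
    have hp : 0 < (θ ^ (2 * k)) ^ D (k + 1) * A (D (k + 1)) := mul_pos (by positivity) (hpos _)
    have h3 : 0 < (θ ^ 2) ^ D k := by positivity
    nlinarith [mul_le_mul_of_nonneg_right h2 h3.le, mul_lt_mul_of_pos_right hlt' hp]
  -- The same exponent is maximal at `θ^(2k)` and `θ^(2k+2)`. At the scale between, it beats lower
  -- exponents by comparison with the smaller scale and higher ones with the larger, gaining at
  -- least `θ⁻¹`.
  obtain ⟨k, hk, hkeq⟩ := exists_succ_eq_of_antitone D (hDn 0) hanti
  refine ⟨k, hk, D k, hDn k, hpos k, fun e he hne => ?_⟩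
  rcases lt_or_gt_of_ne hne with hlt | hlt
  · obtain ⟨j, hj⟩ := Nat.exists_eq_add_of_lt hlt
    have h := hDmax (k + 1) e he
    rw [hkeq, hj] at h
    rw [hj]
    have h1 : θ ^ (j + 1) ≤ θ := by
      simpa using pow_le_pow_of_le_one hθ.le hθ1.le (Nat.le_add_left 1 j)
    have ha : 0 ≤ A (e + j + 1) := hA _
    have hs : ∀ i : ℕ, (θ ^ (2 * (k + 1))) ^ i = (θ ^ (2 * k + 1)) ^ i * θ ^ i := by
      intro i; rw [← mul_pow]; congr 1
    rw [hs, hs] at h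
    have h2 : (θ ^ (2 * k + 1)) ^ e * A e ≤
        θ ^ (j + 1) * ((θ ^ (2 * k + 1)) ^ (e + j + 1) * A (e + j + 1)) := by
      refine le_of_mul_le_mul_left ?_ (pow_pos hθ e)
      calc _ = (θ ^ (2 * k + 1)) ^ e * θ ^ e * A e := by ring
        _ ≤ _ := h
        _ = _ := by rw [show θ ^ (e + j + 1) = θ ^ e * θ ^ (j + 1) by ring]; ring
    exact h2.trans (mul_le_mul_of_nonneg_right h1 (by positivity))
  · obtain ⟨j, hj⟩ := Nat.exists_eq_add_of_lt hlt
    have h := hDmax k e he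
    have ha : 0 ≤ A e := hA _
    have h1 : θ ^ (j + 1) ≤ θ := by
      simpa using pow_le_pow_of_le_one hθ.le hθ1.le (Nat.le_add_left 1 j)
    have hs : ∀ i : ℕ, (θ ^ (2 * k + 1)) ^ i = (θ ^ (2 * k)) ^ i * θ ^ i := by
      intro i; rw [← mul_pow]; congr 1
    rw [hs, hs]
    have hD0 := (hpos k).le
    calc (θ ^ (2 * k)) ^ e * θ ^ e * A e = θ ^ e * ((θ ^ (2 * k)) ^ e * A e) := by ring
      _ ≤ θ ^ e * ((θ ^ (2 * k)) ^ D k * A (D k)) := by gcongr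
      _ = θ ^ (j + 1) * (θ ^ D k * ((θ ^ (2 * k)) ^ D k * A (D k))) := by
        rw [hj]; ring
      _ ≤ θ * (θ ^ D k * ((θ ^ (2 * k)) ^ D k * A (D k))) := by gcongr
      _ = _ := by ring

theorem MvPolynomial.IsHomogeneous.eval_smul {σ : Type*} {P : MvPolynomial σ ℝ} {d : ℕ}
    (hP : P.IsHomogeneous d) (t : ℝ) (u : σ → ℝ) :
    MvPolynomial.eval (t • u) P = t ^ d * MvPolynomial.eval u P := by
  rw [MvPolynomial.eval_eq, MvPolynomial.eval_eq, Finset.mul_sum]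
  refine Finset.sum_congr rfl fun m hm => ?_
  have := hP (MvPolynomial.mem_support_iff.1 hm)
  rw [Finsupp.weight_apply] at this
  simp only [Pi.one_apply, smul_eq_mul, mul_one, Finsupp.sum] at this
  simp only [Pi.smul_apply, smul_eq_mul, mul_pow, Finset.prod_mul_distrib]
  rw [Finset.prod_pow_eq_pow_sum, this]
  ring

theorem eval_smul_eq_sum_homogeneousComponent {σ : Type*} (f : MvPolynomial σ ℝ) (t : ℝ)
    (u : σ → ℝ) : MvPolynomial.eval (t • u) f =
      ∑ e ∈ Finset.range (f.totalDegree + 1),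
        t ^ e * MvPolynomial.eval u (MvPolynomial.homogeneousComponent e f) := by
  conv_lhs => rw [← MvPolynomial.sum_homogeneousComponent f]
  rw [map_sum]
  exact Finset.sum_congr rfl fun e _ =>
    (MvPolynomial.homogeneousComponent_isHomogeneous e f).eval_smul t u

theorem exists_abs_eval_max_on_box (P : MvPolynomial (Fin 2) ℝ) :
    ∃ v : Fin 2 → ℝ, (∀ i, |v i| ≤ 1) ∧
      ∀ u : Fin 2 → ℝ, (∀ i, |u i| ≤ 1) → |MvPolynomial.eval u P| ≤ |MvPolynomial.eval v P| := by
  have hc : IsCompact (Set.univ.pi fun _ : Fin 2 => Set.Icc (-1 : ℝ) 1) :=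
    isCompact_univ_pi fun _ => isCompact_Icc
  have hm : ∀ u : Fin 2 → ℝ,
      u ∈ (Set.univ.pi fun _ : Fin 2 => Set.Icc (-1 : ℝ) 1) ↔ ∀ i, |u i| ≤ 1 := by
    intro u; simp only [Set.mem_univ_pi, Set.mem_Icc, abs_le]
  obtain ⟨v, hv, hmax⟩ := hc.exists_isMaxOn ⟨0, by rw [hm]; simp⟩
    (f := fun u => |MvPolynomial.eval u P|) (MvPolynomial.continuous_eval P).abs.continuousOn
  exact ⟨v, (hm v).1 hv, fun u hu => hmax ((hm u).2 hu)⟩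

/-- If a homogeneous `P` approximates `f` at scale `t`, then `P` is small on a quarter of the
square: in the first quadrant for even degree, in the second one for odd degree. -/
theorem IsSharpTurn.exists_box {f : MvPolynomial (Fin 2) ℝ} {ε : ℝ} (hε : 0 < ε)
    (hf : IsSharpTurn f ε) {t : ℝ} (htε : ε < t / 2) (ht1 : t ≤ 1) {P : MvPolynomial (Fin 2) ℝ}
    {d : ℕ} (hP : P.IsHomogeneous d) {η : ℝ}
    (herr : ∀ u : Fin 2 → ℝ, (∀ i, |u i| ≤ 1) →
      |MvPolynomial.eval (t • u) f - t ^ d * MvPolynomial.eval u P| ≤ t ^ d * η) :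
    ∃ c : Fin 2 → ℝ, (∀ i, |c i| ≤ 3 / 4) ∧
      ∀ u : Fin 2 → ℝ, (∀ i, |u i - c i| ≤ 1 / 4) → |MvPolynomial.eval u P| ≤ η := by
  obtain ⟨h1, h2, h3⟩ := hf
  have ht0 : 0 < t := by linarith
  have htd : 0 < t ^ d := pow_pos ht0 d
  have hvec : ∀ u : Fin 2 → ℝ, t • u = ![t * u 0, t * u 1] := by
    intro u; ext i; fin_cases i <;> simp
  have hneg : ∀ u : Fin 2 → ℝ,
      MvPolynomial.eval (-u) P = (-1) ^ d * MvPolynomial.eval u P := by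
    intro u
    rw [← hP.eval_smul (-1) u, neg_one_smul]
  rcases Nat.even_or_odd d with he | ho
  -- Coordinates in the box are at least `1/2`, so `t * u i > ε`. Here `f` changes sign between `tu`
  -- and `-tu`, while `P` is even.
  · refine ⟨![3 / 4, 3 / 4], by intro i; fin_cases i <;> norm_num [abs_le], fun u hu => ?_⟩
    have u0 := abs_le.1 (hu 0)
    have u1 := abs_le.1 (hu 1)
    simp only [Matrix.cons_val_zero, Matrix.cons_val_one] at u0 u1
    have hu1 : ∀ i, |u i| ≤ 1 := by
      intro i; rw [abs_le]; fin_cases i <;> constructor <;> simp <;> linarith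
    have e1 := abs_le.1 (herr u hu1)
    have e2 := abs_le.1 (herr (-u) (by simpa using hu1))
    rw [hneg, he.neg_one_pow, one_mul] at e2
    have s1 := h1 (t * u 0) (t * u 1) (by nlinarith) (by nlinarith) (by nlinarith) (by nlinarith)
    have s2 := h3 (t * (-u) 0) (t * (-u) 1) (by simp; nlinarith) (by simp; nlinarith)
      (by simp; nlinarith) (by simp; nlinarith)
    rw [← hvec] at s1 s2
    rw [abs_le]
    constructor
    · refine le_of_mul_le_mul_left ?_ htd; linarith
    · refine le_of_mul_le_mul_left ?_ htd; linarith
  -- Now `f` is positive at both `tu` and `-tu`, while `P` is odd.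
  · refine ⟨![-3 / 4, 3 / 4], by intro i; fin_cases i <;> norm_num [abs_le], fun u hu => ?_⟩
    have u0 := abs_le.1 (hu 0)
    have u1 := abs_le.1 (hu 1)
    simp only [Matrix.cons_val_zero, Matrix.cons_val_one] at u0 u1
    have hu1 : ∀ i, |u i| ≤ 1 := by
      intro i; rw [abs_le]; fin_cases i <;> constructor <;> simp <;> linarith
    have e1 := abs_le.1 (herr u hu1)
    have e2 := abs_le.1 (herr (-u) (by simpa using hu1))
    rw [hneg, ho.neg_one_pow] at e2
    have s1 := h2 (t * u 0) (t * u 1) (by nlinarith) (by nlinarith) (by nlinarith) (by nlinarith)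
    have s2 := h1 (t * (-u) 0) (t * (-u) 1) (by simp; nlinarith) (by simp; nlinarith)
      (by simp; nlinarith) (by simp; nlinarith)
    rw [← hvec] at s1 s2
    rw [abs_le]
    constructor
    · refine le_of_mul_le_mul_left ?_ htd; linarith
    · refine le_of_mul_le_mul_left ?_ htd; linarith

theorem IsSharpTurn.le_size {f : MvPolynomial (Fin 2) ℝ} {ε : ℝ} (hε : 0 < ε)
    (hf : IsSharpTurn f ε) :
    ((1 / 30 : ℝ) ^ (f.totalDegree + 1)) ^ (2 * f.totalDegree + 1) / 2 ≤ ε := by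
  set n := f.totalDegree with hn
  set θ : ℝ := (1 / 30) ^ (n + 1) with hθdef
  have hθ : 0 < θ := by positivity
  have hθ1 : θ < 1 := pow_lt_one₀ (by norm_num) (by norm_num) (by omega)
  by_contra! hlt
  have hε1 : ε < 1 := by
    have : θ ^ (2 * n + 1) ≤ 1 := pow_le_one₀ hθ.le hθ1.le
    linarith
  set P : ℕ → MvPolynomial (Fin 2) ℝ := fun e => MvPolynomial.homogeneousComponent e f with hP
  choose v hv hmax using fun e => exists_abs_eval_max_on_box (P e)
  set A : ℕ → ℝ := fun e => |MvPolynomial.eval (v e) (P e)| with hAdef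
  have hA0 : ∃ e ≤ n, 0 < A e := by
    by_contra! h
    have h11 := hf.1 1 1 hε1.le le_rfl (by norm_num) le_rfl
    have hz := eval_smul_eq_sum_homogeneousComponent f 1 ![1, 1]
    rw [one_smul] at hz
    rw [hz, Finset.sum_eq_zero] at h11
    · exact lt_irrefl _ h11
    · intro e he
      have h4 := h e (by simpa [Nat.lt_succ_iff] using he)
      have h5 := hmax e ![1, 1] (by intro i; fin_cases i <;> simp)
      rw [abs_nonpos_iff.1 (h5.trans h4), mul_zero]
  obtain ⟨k, hk, d, hd, hAd, hdom⟩ :=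
    exists_scale_of_dominant_term n A (fun e => abs_nonneg _) hA0 hθ hθ1
  set t : ℝ := θ ^ (2 * k + 1) with ht
  have ht0 : 0 < t := by positivity
  have ht1 : t ≤ 1 := pow_le_one₀ hθ.le hθ1.le
  have htε : ε < t / 2 := by
    have : θ ^ (2 * n + 1) ≤ t := pow_le_pow_of_le_one hθ.le hθ1.le (by omega)
    linarith
  have herr : ∀ u : Fin 2 → ℝ, (∀ i, |u i| ≤ 1) →
      |MvPolynomial.eval (t • u) f - t ^ d * MvPolynomial.eval u (P d)| ≤
        t ^ d * ((n + 1) * θ * A d) := by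
    intro u hu
    rw [eval_smul_eq_sum_homogeneousComponent, ← hn,
      ← Finset.add_sum_erase _ _ (Finset.mem_range.2 (Nat.lt_succ_of_le hd)), add_sub_cancel_left]
    calc _ ≤ ∑ e ∈ (Finset.range (n + 1)).erase d, |t ^ e * MvPolynomial.eval u (P e)| :=
          Finset.abs_sum_le_sum_abs _ _
      _ ≤ ∑ e ∈ (Finset.range (n + 1)).erase d, θ * (t ^ d * A d) := by
          refine Finset.sum_le_sum fun e he => ?_
          rw [Finset.mem_erase, Finset.mem_range] at he
          rw [abs_mul, abs_of_pos (pow_pos ht0 e)]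
          exact (mul_le_mul_of_nonneg_left (hmax e u hu) (pow_pos ht0 e).le).trans
            (hdom e (by omega) he.1)
      _ ≤ _ := by
          rw [Finset.sum_const, nsmul_eq_mul]
          have hc : (((Finset.range (n + 1)).erase d).card : ℝ) ≤ n + 1 := by
            have := Finset.card_erase_le (s := Finset.range (n + 1)) (a := d)
            rw [Finset.card_range] at this
            exact_mod_cast this
          have : 0 ≤ θ * (t ^ d * A d) := by positivity
          calc _ ≤ ((n : ℝ) + 1) * (θ * (t ^ d * A d)) := mul_le_mul_of_nonneg_right hc this
            _ = _ := by ring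
  obtain ⟨c, hc, hsmall⟩ :=
    hf.exists_box hε htε ht1
      (MvPolynomial.homogeneousComponent_isHomogeneous d f) herr
  have hfin := abs_eval_le_of_abs_le_on_box (P d) (d := n)
    ((MvPolynomial.homogeneousComponent_isHomogeneous d f).totalDegree_le.trans hd) hc
    (δ := (n + 1) * θ * A d) (by positivity) hsmall (hv d)
  -- The base 30 in `θ` exceeds `28 = 14 · 2`, the 2 absorbing `n + 1`.
  have hsm : (14 : ℝ) ^ n * ((n + 1) * θ) < 1 := by
    have hb : (n + 1 : ℝ) ≤ 2 ^ n := by exact_mod_cast Nat.lt_two_pow_self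
    calc (14 : ℝ) ^ n * ((n + 1) * θ) ≤ 14 ^ n * (2 ^ n * θ) := by gcongr
      _ = (14 * 2 * (1 / 30)) ^ n * (1 / 30) := by rw [hθdef, mul_pow, mul_pow]; ring
      _ ≤ 1 * (1 / 30) := by
        gcongr
        exact pow_le_one₀ (by norm_num) (by norm_num)
      _ < 1 := by norm_num
  have hAd' : A d ≤ 14 ^ n * ((n + 1) * θ) * A d := hfin.trans (le_of_eq (by ring))
  exact absurd (hAd'.trans_lt (mul_lt_of_lt_one_left hAd hsm)) (lt_irrefl _)

theorem IsSharpTurn.exp_le_size {n : ℕ} {f : MvPolynomial (Fin 2) ℝ} {ε : ℝ}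
    (hn : f.totalDegree = n) (hε : 0 < ε) (hf : IsSharpTurn f ε) :
    1 / 60 * Real.exp (-(5 * Real.log 30) * (n : ℝ) ^ 2) ≤ ε := by
  refine le_trans ?_ (hf.le_size hε)
  rw [hn, ← pow_mul]
  have he : Real.exp (-(5 * Real.log 30) * (n : ℝ) ^ 2) = (1 / 30 : ℝ) ^ (5 * n ^ 2) := by
    rw [one_div, ← Real.exp_log (show (0 : ℝ) < 30⁻¹ by norm_num), ← Real.exp_nat_mul, Real.log_inv]
    congr 1
    push_cast
    ring
  have hle : (1 / 30 : ℝ) ^ (5 * n ^ 2 + 1) ≤ (1 / 30) ^ ((n + 1) * (2 * n + 1)) :=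
    pow_le_pow_of_le_one (by norm_num) (by norm_num) (by nlinarith [Nat.le_self_pow two_ne_zero n])
  rw [he]
  rw [pow_succ] at hle
  linarith

end LowerBound

/-! ### The iteration for `p`, `q` and `K`. -/

namespace SharpTurn

section Iteration

variable {a : ℝ}

theorem one_le_K (ha : 0 < a) (ha1 : a ≤ 1) (m : ℕ) : 1 ≤ K a m := by
  induction m with
  | zero => rw [K, le_div_iff₀ ha]; linarith
  | succ m ih =>
    have hs : 0 < Real.sqrt (K a m) := Real.sqrt_pos.2 (by linarith)
    have : Real.sqrt (K a m) + 1 / Real.sqrt (K a m) - 2 =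
        (Real.sqrt (K a m) - 1) ^ 2 / Real.sqrt (K a m) := by field_simp; ring
    have h2 : 0 ≤ (Real.sqrt (K a m) - 1) ^ 2 / Real.sqrt (K a m) := by positivity
    rw [K]
    linarith

theorem K_succ_sq_le (ha : 0 < a) (ha1 : a ≤ 1) (m : ℕ) : K a (m + 1) ^ 2 ≤ K a m := by
  have h1 := one_le_K ha ha1 m
  have hs : 1 ≤ Real.sqrt (K a m) := Real.one_le_sqrt.2 h1
  have hi : 1 / Real.sqrt (K a m) ≤ 1 := by rw [div_le_one (by linarith)]; exact hs
  have hle : K a (m + 1) ≤ Real.sqrt (K a m) := by rw [K]; linarith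
  calc K a (m + 1) ^ 2 ≤ Real.sqrt (K a m) ^ 2 :=
        pow_le_pow_left₀ (by linarith [one_le_K ha ha1 (m + 1)]) hle 2
    _ = K a m := Real.sq_sqrt (by linarith)

theorem K_pow_two_pow_le (ha : 0 < a) (ha1 : a ≤ 1) (m : ℕ) : K a m ^ 2 ^ m ≤ 1 / a := by
  induction m with
  | zero => simp [K]
  | succ m ih =>
    rw [pow_succ 2, mul_comm, pow_mul]
    exact (pow_le_pow_left₀ (by positivity) (K_succ_sq_le ha ha1 m) _).trans ih

/-- The last inequality propagates by AM-GM on `p²` and `K y² q²`. -/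
theorem pq_bounds (ha : 0 < a) (ha1 : a ≤ 1) (m : ℕ) {y : ℝ} (hy : |y| ≤ 1) :
    0 < (pq a m).1.eval y ∧ 0 < (pq a m).2.eval y ∧
      |y| * (pq a m).2.eval y ≤ (pq a m).1.eval y := by
  induction m with
  | zero => simpa [pq] using hy
  | succ m ih =>
    obtain ⟨hp, hq, hle⟩ := ih
    have hK := one_le_K ha ha1 m
    have hs : 0 < Real.sqrt (K a m) := Real.sqrt_pos.2 (by linarith)
    have hsq := Real.sq_sqrt (show 0 ≤ K a m by linarith)
    simp only [pq, Polynomial.eval_add, Polynomial.eval_mul, Polynomial.eval_pow,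
      Polynomial.eval_C, Polynomial.eval_X]
    refine ⟨by positivity, by positivity, ?_⟩
    rw [← sq_abs y]
    generalize Real.sqrt (K a m) = s at *
    rw [← hsq]
    nlinarith [sq_nonneg ((pq a m).1.eval y - s * |y| * (pq a m).2.eval y)]

/-- The ratio `r = p / (|y| q)` evolves by `r ↦ (r/√K + √K/r)/2`, which on `[1, K]` is largest at
both endpoints, with value `K_{m+1}`. -/
theorem eval_pq_fst_le (ha : 0 < a) (ha1 : a ≤ 1) (m : ℕ) {y : ℝ} (hay : a ≤ |y|)
    (hy : |y| ≤ 1) : (pq a m).1.eval y ≤ K a m * (|y| * (pq a m).2.eval y) := by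
  induction m with
  | zero =>
    simp only [pq, K, Polynomial.eval_one, mul_one]
    rw [one_div, le_inv_mul_iff₀ ha]
    linarith
  | succ m ih =>
    obtain ⟨hp, hq, hle⟩ := pq_bounds ha ha1 m hy
    have hK := one_le_K ha ha1 m
    have hs : 0 < Real.sqrt (K a m) := Real.sqrt_pos.2 (by linarith)
    have hsq := Real.sq_sqrt (show 0 ≤ K a m by linarith)
    simp only [pq, K, Polynomial.eval_add, Polynomial.eval_mul, Polynomial.eval_pow,
      Polynomial.eval_C, Polynomial.eval_X]
    rw [← sq_abs y]
    generalize Real.sqrt (K a m) = s at *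
    generalize (pq a m).1.eval y = p at *
    generalize (pq a m).2.eval y = q at *
    generalize |y| = z at *
    rw [← hsq] at ih ⊢
    have e : (s + 1 / s) / 2 * (z * (2 * s * p * q)) = (s ^ 2 + 1) * (p * (z * q)) := by
      field_simp
    rw [e]
    nlinarith [mul_nonneg (sub_nonneg.2 hle) (sub_nonneg.2 ih)]

theorem natDegree_pq_le (a : ℝ) (m : ℕ) :
    (pq a m).1.natDegree ≤ 2 ^ m ∧ (pq a m).2.natDegree + 1 ≤ 2 ^ m := by
  induction m with
  | zero => simp [pq]
  | succ m ih =>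
    obtain ⟨hp, hq⟩ := ih
    rw [pow_succ]
    simp only [pq]
    constructor
    · refine (Polynomial.natDegree_add_le _ _).trans (max_le ?_ ?_)
      · exact (Polynomial.natDegree_pow_le).trans (by omega)
      · refine (Polynomial.natDegree_mul_le).trans ?_
        have h1 : (Polynomial.C (K a m) * Polynomial.X ^ 2).natDegree ≤ 2 :=
          Polynomial.natDegree_C_mul_X_pow_le _ _
        have h2 := Polynomial.natDegree_pow_le (p := (pq a m).2) (n := 2)
        omega
    · have h1 := Polynomial.natDegree_mul_le
        (p := Polynomial.C (2 * Real.sqrt (K a m)) * (pq a m).1) (q := (pq a m).2)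
      have h2 := Polynomial.natDegree_C_mul_le (2 * Real.sqrt (K a m)) (pq a m).1
      omega

end Iteration

/-! ### The product `g`. -/

theorem eval_g (N : ℕ) (x : ℝ) :
    (g N).eval x = ∏ m ∈ Finset.Icc 1 N, (x + 1 / 2 ^ m) ^ 2 := by
  simp [g, Polynomial.eval_prod]

theorem eval_g_succ (N : ℕ) (x : ℝ) :
    (g (N + 1)).eval x = (g N).eval x * (x + 1 / 2 ^ (N + 1)) ^ 2 := by
  rw [eval_g, eval_g, Finset.prod_Icc_succ_top (by omega)]

theorem eval_g_nonneg (N : ℕ) (x : ℝ) : 0 ≤ (g N).eval x := by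
  rw [eval_g]; exact Finset.prod_nonneg fun _ _ => sq_nonneg _

theorem eval_g_pos (N : ℕ) {x : ℝ} (hx : 0 ≤ x) : 0 < (g N).eval x := by
  rw [eval_g]; exact Finset.prod_pos fun _ _ => by positivity

theorem eval_g_neg_le (N : ℕ) {s : ℝ} (hs : 0 ≤ s) : (g N).eval (-s) ≤ (g N).eval s := by
  rw [eval_g, eval_g]
  refine Finset.prod_le_prod (fun _ _ => sq_nonneg _) fun m _ => ?_
  have : (0 : ℝ) < 1 / 2 ^ m := by positivity
  nlinarith

/-- Some root parameter `b = 2^{-m}` has `b ≤ s ≤ 2b`, and that factor alone gives 9; the others do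
no harm. -/
theorem nine_mul_eval_g_neg_le {N : ℕ} (hN : 1 ≤ N) {s : ℝ} (hs : (1 / 2) ^ N ≤ s)
    (hs1 : s ≤ 1) : 9 * (g N).eval (-s) ≤ (g N).eval s := by
  have key : ∀ b : ℝ, 0 < b → b ≤ s → s ≤ 2 * b → 9 * (-s + b) ^ 2 ≤ (s + b) ^ 2 := by
    intro b hb h1 h2
    nlinarith [mul_nonneg (sub_nonneg.2 h2) (show 0 ≤ 2 * s - b by linarith)]
  induction N, hN using Nat.le_induction with
  | base =>
    simp only [eval_g, Finset.Icc_self, Finset.prod_singleton]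
    norm_num at hs
    exact key _ (by norm_num) (by linarith) (by linarith)
  | succ N hN ih =>
    have hb : (0 : ℝ) < 1 / 2 ^ (N + 1) := by positivity
    have hs0 : 0 ≤ s := le_trans (by positivity) hs
    rw [eval_g_succ, eval_g_succ]
    rcases le_total ((1 / 2) ^ N) s with h | h
    · have hfac : (-s + 1 / 2 ^ (N + 1)) ^ 2 ≤ (s + 1 / 2 ^ (N + 1)) ^ 2 := by nlinarith
      rw [← mul_assoc]
      exact mul_le_mul (ih h) hfac (sq_nonneg _) (eval_g_nonneg _ _)
    · have hfac := key (1 / 2 ^ (N + 1)) hb (by rwa [← one_div_pow])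
        (h.trans (le_of_eq (by rw [one_div_pow, pow_succ]; field_simp)))
      rw [mul_left_comm]
      exact mul_le_mul (eval_g_neg_le N hs0) hfac (by positivity) (eval_g_nonneg _ _)

theorem natDegree_g_le (N : ℕ) : (g N).natDegree ≤ 2 * N := by
  refine (Polynomial.natDegree_prod_le _ _).trans ?_
  calc _ ≤ ∑ _m ∈ Finset.Icc 1 N, 2 := Finset.sum_le_sum fun m _ => by compute_degree
    _ = 2 * N := by simp [mul_comm]

/-! ### Degree and signs of the superposition. -/

theorem totalDegree_aeval_le {σ : Type*} (P : Polynomial ℝ) {r : MvPolynomial σ ℝ}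
    (hr : r.totalDegree ≤ 1) : (Polynomial.aeval r P).totalDegree ≤ P.natDegree := by
  rw [Polynomial.aeval_eq_sum_range]
  refine MvPolynomial.totalDegree_finsetSum_le fun i hi => ?_
  refine (MvPolynomial.totalDegree_smul_le _ _).trans ((MvPolynomial.totalDegree_pow _ _).trans ?_)
  have := Finset.mem_range.1 hi
  nlinarith

theorem totalDegree_superposition_le (a : ℝ) (m N : ℕ) :
    (superposition a m N).totalDegree ≤ 2 ^ m + 2 * N := by
  obtain ⟨hp, hq⟩ := natDegree_pq_le a m
  have hg := natDegree_g_le N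
  have hX : ∀ i : Fin 2, (MvPolynomial.X i : MvPolynomial (Fin 2) ℝ).totalDegree ≤ 1 :=
    fun i => (MvPolynomial.totalDegree_X i).le
  have hnX : (-MvPolynomial.X 0 : MvPolynomial (Fin 2) ℝ).totalDegree ≤ 1 := by
    rw [MvPolynomial.totalDegree_neg]; exact hX 0
  have h1 := totalDegree_aeval_le (pq a m).1 (hX 1)
  have h2 := totalDegree_aeval_le (pq a m).2 (hX 1)
  have h3 := totalDegree_aeval_le (g N) (hX 0)
  have h4 := totalDegree_aeval_le (g N) hnX
  refine (MvPolynomial.totalDegree_add _ _).trans (max_le ?_ ?_)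
  · exact (MvPolynomial.totalDegree_mul _ _).trans (by omega)
  · refine (MvPolynomial.totalDegree_mul _ _).trans ?_
    have h5 := MvPolynomial.totalDegree_mul (MvPolynomial.X 1 : MvPolynomial (Fin 2) ℝ)
      (Polynomial.aeval (MvPolynomial.X 1) (pq a m).2)
    have h6 := hX 1
    omega

theorem eval_superposition (a : ℝ) (m N : ℕ) (x y : ℝ) :
    MvPolynomial.eval ![x, y] (superposition a m N) =
      (pq a m).1.eval y * (g N).eval x + y * (pq a m).2.eval y * (g N).eval (-x) := by
  have h : ∀ (P : Polynomial ℝ) (r : MvPolynomial (Fin 2) ℝ),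
      MvPolynomial.eval ![x, y] (Polynomial.aeval r P) = P.eval (MvPolynomial.eval ![x, y] r) := by
    intro P r
    rw [← MvPolynomial.coe_aeval_eq_eval]
    exact (Polynomial.aeval_algHom_apply (MvPolynomial.aeval ![x, y]) r P).symm.trans
      (by rw [Polynomial.coe_aeval_eq_eval]; rfl)
  simp [superposition, h]

theorem isSharpTurn_superposition {a : ℝ} {m N : ℕ} (hN : 1 ≤ N) (ha : a = (1 / 2) ^ N)
    (hK : K a m < 9) : IsSharpTurn (superposition a m N) a := by
  have ha0 : 0 < a := by rw [ha]; positivity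
  have ha1 : a ≤ 1 := by rw [ha]; exact pow_le_one₀ (by norm_num) (by norm_num)
  refine ⟨fun x y hx hx1 hy hy1 => ?_, fun x y hy hy1 hx hx1 => ?_, fun x y hx hx1 hy hy1 => ?_⟩
  all_goals
    obtain ⟨hp, hq, hle⟩ := pq_bounds ha0 ha1 m (y := y) (abs_le.2 ⟨by linarith, by linarith⟩)
    rw [eval_superposition]
  · have h9 := nine_mul_eval_g_neg_le hN (ha ▸ hx) hx1
    have hg := eval_g_pos N (ha0.le.trans hx)
    have hg' := eval_g_nonneg N (-x)
    have h1 : -(|y| * (pq a m).2.eval y) ≤ y * (pq a m).2.eval y := by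
      nlinarith [neg_abs_le y]
    have h2 : (g N).eval (-x) < (g N).eval x := by linarith
    have h3 : -(pq a m).1.eval y ≤ y * (pq a m).2.eval y := by linarith
    nlinarith [mul_le_mul_of_nonneg_right h3 hg', mul_lt_mul_of_pos_left h2 hp]
  · have hyq : 0 < y * (pq a m).2.eval y := mul_pos (by linarith) hq
    have hg := eval_g_nonneg N x
    have hg' := eval_g_nonneg N (-x)
    rcases le_total 0 x with h | h
    · have := mul_pos hp (eval_g_pos N h)
      nlinarith [mul_nonneg hyq.le hg']
    · have := mul_pos hyq (eval_g_pos N (neg_nonneg.2 h))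
      nlinarith [mul_nonneg hp.le hg]
  · have habs : |y| = -y := abs_of_neg (by linarith)
    have h9 := nine_mul_eval_g_neg_le hN (s := -x) (by rw [← ha]; linarith) (by linarith)
    rw [neg_neg] at h9
    have hpK := eval_pq_fst_le ha0 ha1 m (y := y) (by linarith) (by linarith)
    rw [habs] at hpK
    have hg := eval_g_nonneg N x
    have hg' := eval_g_pos N (x := -x) (by linarith)
    have hY : 0 < -y * (pq a m).2.eval y := mul_pos (by linarith) hq
    have hK0 := one_le_K ha0 ha1 m
    have h1 : (pq a m).1.eval y * (g N).eval x ≤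
        K a m * (-y * (pq a m).2.eval y) * (g N).eval x := mul_le_mul_of_nonneg_right hpK hg
    have h2 : K a m * (g N).eval x < (g N).eval (-x) := by
      -- `x` may be a zero `-2^{-m}` of `g`.
      rcases hg.eq_or_lt with h0 | h0
      · rw [← h0, mul_zero]; exact hg'
      · nlinarith
    nlinarith [mul_lt_mul_of_pos_left h2 hY]

theorem isSharpTurn_superposition_two_pow (M : ℕ) :
    IsSharpTurn (superposition ((1 / 2) ^ 2 ^ M) M (2 ^ M)) ((1 / 2) ^ 2 ^ M) := by
  refine isSharpTurn_superposition Nat.one_le_two_pow rfl ?_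
  have ha : (0 : ℝ) < (1 / 2) ^ 2 ^ M := by positivity
  have ha1 : (1 / 2 : ℝ) ^ 2 ^ M ≤ 1 := pow_le_one₀ (by norm_num) (by norm_num)
  have h := K_pow_two_pow_le ha ha1 M
  rw [one_div_pow, one_div_one_div] at h
  have := le_of_pow_le_pow_left₀ (by positivity) (by norm_num) h
  rw [one_div_pow]
  linarith

theorem exists_superposition {n : ℕ} (hn : 3 ≤ n) :
    ∃ M : ℕ, (superposition ((1 / 2) ^ 2 ^ M) M (2 ^ M)).totalDegree ≤ n ∧
      ((1 / 2 : ℝ) ^ 2 ^ M) ≤ 2 * Real.exp (-(Real.log 2 / 6) * n) := by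
  -- With `N = 2^M` the degree is at most `3 · 2^M`; the largest admissible `M` has `n ≤ 6 · 2^M`,
  -- hence the rate `log 2 / 6`.
  refine ⟨Nat.log 2 (n / 3), ?_, ?_⟩
  · have h1 : 2 ^ Nat.log 2 (n / 3) ≤ n / 3 := Nat.pow_log_le_self 2 (by omega)
    exact (totalDegree_superposition_le _ _ _).trans (by omega)
  · have h2 : n / 3 < 2 ^ (Nat.log 2 (n / 3) + 1) := Nat.lt_pow_succ_log_self (by norm_num) _
    rw [pow_succ] at h2
    have h3 : n ≤ 6 * 2 ^ Nat.log 2 (n / 3) := by omega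
    have h3' : (n : ℝ) ≤ 6 * (2 ^ Nat.log 2 (n / 3) : ℕ) := by exact_mod_cast h3
    have hlog : 0 < Real.log 2 := Real.log_pos (by norm_num)
    generalize 2 ^ Nat.log 2 (n / 3) = N at h3'
    have he : (1 / 2 : ℝ) ^ N = Real.exp (-(Real.log 2) * N) := by
      rw [one_div, ← Real.exp_log (show (0 : ℝ) < 2⁻¹ by norm_num), ← Real.exp_nat_mul,
        Real.log_inv, mul_comm]
    rw [he]
    have hexp : Real.exp (-(Real.log 2) * N) ≤ Real.exp (-(Real.log 2 / 6) * n) :=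
      Real.exp_le_exp.2 (by nlinarith)
    linarith [Real.exp_pos (-(Real.log 2 / 6) * n)]

end SharpTurn

/-! ### Exact degree and small `n`. -/

theorem exists_pos_le_eval_on_rectangle (f : MvPolynomial (Fin 2) ℝ) (x₀ x₁ y₀ y₁ : ℝ)
    (h : ∀ x y : ℝ, x₀ ≤ x → x ≤ x₁ → y₀ ≤ y → y ≤ y₁ → 0 < MvPolynomial.eval ![x, y] f) :
    ∃ δ : ℝ, 0 < δ ∧ ∀ x y : ℝ, x₀ ≤ x → x ≤ x₁ → y₀ ≤ y → y ≤ y₁ →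
      δ ≤ MvPolynomial.eval ![x, y] f := by
  have hcont : Continuous fun z : ℝ × ℝ => MvPolynomial.eval ![z.1, z.2] f := by
    refine (MvPolynomial.continuous_eval f).comp (continuous_pi fun i => ?_)
    fin_cases i
    · exact continuous_fst
    · exact continuous_snd
  obtain ⟨δ, hδ, hle⟩ := ((isCompact_Icc (a := x₀) (b := x₁)).prod
    (isCompact_Icc (a := y₀) (b := y₁))).exists_forall_le' hcont.continuousOn (a := 0)
    fun z hz => h z.1 z.2 hz.1.1 hz.1.2 hz.2.1 hz.2.2
  exact ⟨δ, hδ, fun x y hx hx1 hy hy1 => hle (x, y) ⟨⟨hx, hx1⟩, ⟨hy, hy1⟩⟩⟩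

/-- By compactness the strict signs survive adding `δ x^n` for small `δ`. -/
theorem IsSharpTurn.exists_totalDegree_eq {f : MvPolynomial (Fin 2) ℝ} {ε : ℝ} (hε : 0 < ε)
    (hf : IsSharpTurn f ε) {n : ℕ} (hn : f.totalDegree ≤ n) :
    ∃ f' : MvPolynomial (Fin 2) ℝ, f'.totalDegree = n ∧ IsSharpTurn f' ε := by
  rcases hn.eq_or_lt with h | hlt
  · exact ⟨f, h, hf⟩
  obtain ⟨h1, h2, h3⟩ := hf
  obtain ⟨δ₁, hδ₁, hb1⟩ := exists_pos_le_eval_on_rectangle f ε 1 (-1) 1 h1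
  obtain ⟨δ₂, hδ₂, hb2⟩ := exists_pos_le_eval_on_rectangle f (-1) 1 ε 1
    fun x y hx hx1 hy hy1 => h2 x y hy hy1 hx hx1
  obtain ⟨δ₃, hδ₃, hb3⟩ := exists_pos_le_eval_on_rectangle (-f) (-1) (-ε) (-1) (-ε)
    fun x y hx hx1 hy hy1 => by
      rw [map_neg]; linarith [h3 x y hx hx1 hy hy1]
  obtain ⟨δ, hδ, hδlt⟩ := exists_between (lt_min hδ₁ (lt_min hδ₂ hδ₃))
  rw [lt_min_iff, lt_min_iff] at hδlt
  obtain ⟨l1, l2, l3⟩ := hδlt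
  set u : MvPolynomial (Fin 2) ℝ := MvPolynomial.monomial (Finsupp.single 0 n) δ with hu
  have hudeg : u.totalDegree = n := by
    rw [hu, MvPolynomial.totalDegree_monomial _ hδ.ne', Finsupp.sum_single_index rfl]
  have heval : ∀ x y : ℝ, MvPolynomial.eval ![x, y] (f + u) =
      MvPolynomial.eval ![x, y] f + δ * x ^ n := by
    intro x y
    simp [hu, MvPolynomial.eval_monomial]
  have hsmall : ∀ x : ℝ, -1 ≤ x → x ≤ 1 → -δ ≤ δ * x ^ n ∧ δ * x ^ n ≤ δ := by
    intro x hx hx1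
    have : |x ^ n| ≤ 1 := by rw [abs_pow]; exact pow_le_one₀ (abs_nonneg _) (abs_le.2 ⟨hx, hx1⟩)
    have := abs_le.1 this
    constructor <;> nlinarith
  refine ⟨f + u, ?_, fun x y hx hx1 hy hy1 => ?_, fun x y hy hy1 hx hx1 => ?_,
    fun x y hx hx1 hy hy1 => ?_⟩
  · rw [MvPolynomial.totalDegree_add_eq_right_of_totalDegree_lt (by rw [hudeg]; exact hlt), hudeg]
  · rw [heval]
    linarith [hb1 x y hx hx1 hy hy1, hsmall x (by linarith) hx1]
  · rw [heval]
    linarith [hb2 x y hx hx1 hy hy1, hsmall x hx hx1]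
  · rw [heval]
    have := hb3 x y hx hx1 hy hy1
    rw [map_neg] at this
    linarith [hsmall x hx (by linarith)]

theorem isSharpTurn_linear :
    IsSharpTurn (MvPolynomial.X 0 + MvPolynomial.X 1 + MvPolynomial.C (3 / 4)) (1 / 2) := by
  refine ⟨fun x y _ _ _ _ => ?_, fun x y _ _ _ _ => ?_, fun x y _ _ _ _ => ?_⟩ <;>
    simp <;> linarith

theorem totalDegree_linear_le : (MvPolynomial.X 0 + MvPolynomial.X 1 + MvPolynomial.C (3 / 4) :
    MvPolynomial (Fin 2) ℝ).totalDegree ≤ 1 := by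
  refine (MvPolynomial.totalDegree_add _ _).trans (max_le ?_ (by simp))
  refine (MvPolynomial.totalDegree_add _ _).trans (max_le ?_ ?_) <;>
    rw [MvPolynomial.totalDegree_X]

theorem exists_isSharpTurn_totalDegree_eq {n : ℕ} (hn : 1 ≤ n) :
    ∃ (f : MvPolynomial (Fin 2) ℝ) (ε : ℝ), f.totalDegree = n ∧ 0 < ε ∧ ε < 1 ∧
      IsSharpTurn f ε ∧ ε ≤ 2 * Real.exp (-(Real.log 2 / 6) * n) := by
  rcases le_or_gt 3 n with h | h
  · obtain ⟨M, hdeg, hle⟩ := SharpTurn.exists_superposition h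
    have hε : (0 : ℝ) < (1 / 2) ^ 2 ^ M := by positivity
    obtain ⟨f, hfn, hf⟩ :=
      (SharpTurn.isSharpTurn_superposition_two_pow M).exists_totalDegree_eq hε hdeg
    exact ⟨f, _, hfn, hε, pow_lt_one₀ (by norm_num) (by norm_num) (by positivity), hf, hle⟩
  · obtain ⟨f, hfn, hf⟩ :=
      isSharpTurn_linear.exists_totalDegree_eq (by norm_num) (totalDegree_linear_le.trans hn)
    refine ⟨f, _, hfn, by norm_num, by norm_num, hf, ?_⟩
    have hlog : 0 < Real.log 2 := Real.log_pos (by norm_num)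
    have hn2 : (n : ℝ) ≤ 2 := by exact_mod_cast (by omega : n ≤ 2)
    -- For `n ≤ 2` the exponential is still at least `1/2`, the size of the linear example.
    have he : Real.exp (-Real.log 2) ≤ Real.exp (-(Real.log 2 / 6) * n) :=
      Real.exp_le_exp.2 (by nlinarith)
    rw [Real.exp_neg, Real.exp_log (by norm_num)] at he
    linarith

theorem theorem1 :
    (∃ c C : ℝ, 0 < c ∧ 0 < C ∧
      ∀ (n : ℕ) (f : MvPolynomial (Fin 2) ℝ) (ε : ℝ), f.totalDegree = n → 0 < ε →
        IsSharpTurn f ε → c * Real.exp (-C * (n : ℝ) ^ 2) ≤ ε) ∧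
    (∃ c C : ℝ, 0 < c ∧ 0 < C ∧
      (∀ n : ℕ, 1 ≤ n →
        ∃ (f : MvPolynomial (Fin 2) ℝ) (ε : ℝ), f.totalDegree = n ∧ 0 < ε ∧ ε < 1 ∧
          IsSharpTurn f ε ∧ ε ≤ c * Real.exp (-C * (n : ℝ))) ∧
      (∀ n : ℕ, 3 ≤ n →
        ∃ (a : ℝ) (m N : ℕ) (ε : ℝ), 0 < a ∧ a < 1 ∧ 0 < ε ∧ ε < 1 ∧
          (SharpTurn.superposition a m N).totalDegree ≤ n ∧
          IsSharpTurn (SharpTurn.superposition a m N) ε ∧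
          ε ≤ c * Real.exp (-C * (n : ℝ)))) := by
  
  refine ⟨⟨1 / 60, 5 * Real.log 30, by norm_num,
      mul_pos (by norm_num) (Real.log_pos (by norm_num)),
      fun n f ε hn hε hf => hf.exp_le_size hn hε⟩,
    ⟨2, Real.log 2 / 6, by norm_num, div_pos (Real.log_pos (by norm_num)) (by norm_num),
      fun n hn => exists_isSharpTurn_totalDegree_eq hn, fun n hn => ?_⟩⟩
  obtain ⟨M, hdeg, hle⟩ := SharpTurn.exists_superposition hn
  have hε : (0 : ℝ) < (1 / 2) ^ 2 ^ M := by positivity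
  have hε1 : (1 / 2 : ℝ) ^ 2 ^ M < 1 := pow_lt_one₀ (by norm_num) (by norm_num) (by positivity)
  exact ⟨_, M, 2 ^ M, _, hε, hε1, hε, hε1, hdeg,
    SharpTurn.isSharpTurn_superposition_two_pow M, hle⟩
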